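/- Let $0<\alpha<1$, let $\theta=1_{[0,\infty)}$, and let $g_{-\alpha}=\frac{1}{\Gamma(1-\alpha)}D\big(\theta(t)t^{-\alpha}\big)$, where $D$ is the distributional derivative on $\mathbb{R}$. For $T\in(0,\infty]$ and a continuous function $u:[0,T)\to\mathbb{R}$, the generalized Caputo derivative of $u$ (with initial value $u(0)$) is the distribution on $(-\infty,T)$ $$D_c^{\alpha}u=g_{-\alpha}*\big((u-u(0))\theta\big),\qquad \langle D_c^\alpha u,\varphi\rangle=\int_0^{T}(u(s)-u(0))\,\langle g_{-\alpha},\varphi(\cdot+s)\rangle\,ds,\quad \varphi\in C_c^\infty((-\infty,T)).$$ For a continuous function $v$ on $[0,T)$, the relation $D_c^{\alpha}u\ge v$ (resp. $\le v$) in the distributional sense means that $\langle D_c^{\alpha}u,\varphi\rangle\ge\int_0^{T}v\varphi\,dt$ (resp. $\le$) for every nonnegative $\varphi\in C_c^\infty((-\infty,T))$. Theorem 3.1. Let $f:[0,\infty)\times\mathbb{R}\to\mathbb{R}$ be continuous and locally Lipschitz in $u$, that is, every point $(t_0,u_0)\in[0,\infty)\times\mathbb{R}$ has a neighbourhood in $[0,\infty)\times\mathbb{R}$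 on which $|f(t,u)-f(t,v)|\le L|u-v|$ with a constant $L$ independent of $t$. Let $T_y,T_z\in(0,\infty]$ and let $y:[0,T_y)\to\mathbb{R}$ and $z:[0,T_z)\to\mathbb{R}$ be continuous functions such that, in the distributional sense, $$D_c^{\alpha}y\ge f(t,y)\ \text{ on } [0,T_y),\qquad D_c^{\alpha}z\le f(t,z)\ \text{ on } [0,T_z),$$ and $y(0)\ge z(0)$. Then $y(t)\ge z(t)$ for all $t\in[0,\min(T_y,T_z))$. If moreover $y(0)>z(0)$, then $y(t)>z(t)$ for all $t\in[0,\min(T_y,T_z))$. -/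

import Mathlib

open Set MeasureTheory Topology TopologicalSpace
open scoped NNReal Distributions LineDeriv

noncomputable section

namespace FracComparison

/-- The interval of existence `[0, T)`, where `T` may be `+∞`. -/
def existInterval (T : EReal) : Set ℝ := {t : ℝ | 0 ≤ t ∧ (t : EReal) < T}

/-- The open set `(-∞, T)`, where `T` may be `+∞`. Distributions "with support in `[0, T)`" are
distributions on this open set that vanish on negative times. -/
def past (T : EReal) : Opens ℝ where
  carrier := {t : ℝ | (t : EReal) < T}
  is_open' := isOpen_Iio.preimage continuous_coe_real_ereal

/-- The function `θ(t) t ^ β` on the real line, where `θ` is the Heaviside function. -/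
def heavisidePow (β : ℝ) (t : ℝ) : ℝ := if 0 ≤ t then t ^ β else 0

/-- The distribution on `ℝ` (test functions on the whole line) given by integration against a
locally integrable function. -/
def regularDistribution (v : ℝ → ℝ) : 𝓓'((⊤ : Opens ℝ), ℝ) :=
  ContinuousLinearMap.toUniformConvergenceCLM _ _ _
    (TestFunction.integralAgainstBilinCLM (ContinuousLinearMap.mul ℝ ℝ) volume v)

/-- The kernel `g_β = (1 / Γ(1 + β)) D (θ(t) t ^ β)` for `-1 < β < 0`, where `D` is the
distributional derivative on `ℝ`. -/
def abelDistribution (β : ℝ) : 𝓓'((⊤ : Opens ℝ), ℝ) :=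
  (Real.Gamma (1 + β))⁻¹ • ∂_{(1 : ℝ)} (regularDistribution (heavisidePow β))

/-- The translate `x ↦ φ (x + s)` of a test function, as a test function on `ℝ`. -/
def translate {Ω : Opens ℝ} (φ : 𝓓(Ω, ℝ)) (s : ℝ) : 𝓓((⊤ : Opens ℝ), ℝ) where
  toFun x := φ (x + s)
  contDiff' := φ.contDiff.comp (contDiff_id.add contDiff_const)
  hasCompactSupport' := φ.hasCompactSupport.comp_homeomorph (Homeomorph.addRight s)
  tsupport_subset' := fun _ _ => trivial

/-- The convolution `S * (θ v)` of a distribution `S` supported in `[0, ∞)` with the function `θ v`,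
where `v` is locally integrable on `[0, T)`. It is the distribution on `(-∞, T)` given by
`⟨S * (θ v), φ⟩ = ∫_{s ≥ 0} v(s) ⟨S, φ(· + s)⟩ ds`. The values of `v` outside `[0, T)` do not matter,
since `φ(· + s)` vanishes near `[0, ∞)` when `s ≥ T`. -/
def convolve (S : 𝓓'((⊤ : Opens ℝ), ℝ)) (v : ℝ → ℝ) {T : EReal} (φ : 𝓓(past T, ℝ)) : ℝ :=
  ∫ s in Ici (0 : ℝ), v s * S (translate φ s)

/-- The generalized Caputo derivative of order `α` of `u`, associated with the initial value `u₀`: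
the distribution `D_c^α u = g_{-α} * ((u - u₀) θ)` on `(-∞, T)`. -/
def caputo (α : ℝ) (u₀ : ℝ) (u : ℝ → ℝ) {T : EReal} (φ : 𝓓(past T, ℝ)) : ℝ :=
  convolve (abelDistribution (-α)) (fun t => u t - u₀) φ

/-- The distribution on `(-∞, T)` defined by the function `θ v`, for `v` locally integrable on
`[0, T)`. -/
def ofFunction (v : ℝ → ℝ) {T : EReal} (φ : 𝓓(past T, ℝ)) : ℝ :=
  ∫ t in Ici (0 : ℝ), v t * φ t

/-- The inequality `S ≤ R` between distributions on `(-∞, T)`, tested on nonnegative test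
functions. -/
def DistribLE {T : EReal} (S R : 𝓓(past T, ℝ) → ℝ) : Prop :=
  ∀ φ : 𝓓(past T, ℝ), (∀ t, 0 ≤ φ t) → S φ ≤ R φ

/-- `f` is locally Lipschitz in its second variable on `[0, ∞) × ℝ`: every point `(t₀, u₀)` has
a neighbourhood in `[0, ∞) × ℝ` on which `f` is Lipschitz in `u`, with a constant that does not
depend on `t`. -/
def LocallyLipschitzInState (f : ℝ → ℝ → ℝ) : Prop :=
  ∀ t₀ : ℝ, 0 ≤ t₀ → ∀ u₀ : ℝ, ∃ L : ℝ≥0, ∃ N ∈ 𝓝 u₀,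
    ∀ᶠ t in 𝓝[Ici 0] t₀, LipschitzOnWith L (f t) N

end FracComparison

end

noncomputable section

namespace FracComparison

open scoped ContDiff Convolution
open Filter

/-! Let `w = z - y` and `K = θ(t) t ^ (-α) / Γ(1 - α)`. Since `y` and `z` are only continuous,
everything is done weakly, by testing the two inequalities with the forward average of a bump `ψ`
against a nonnegative, compactly supported kernel `r`. This kernel is chosen so that `K * r` is the
tail function of a probability density `κ` on `(0, ∞)`. Then `D (K * r) = δ₀ - κ`
(`neg_integral_mul_forwardAverage_deriv`), so the fractional derivative turns into the identity
minus an averaging operator, and subtracting the inequalities gives, weakly, `w - w(0) ≤ κ * (w -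
w(0)) + r * (f(·, z) - f(·, y))`.

Let `L` be a Lipschitz constant of `f` along the two trajectories. If also `L r ≤ κ`, then wherever
`w ≤ 0` the averaging term absorbs the Lipschitz term, and what remains is `w ≤ w(0) ∫_t^∞ κ + (κ +
L r) * w⁺` (`IsKernelPair.integral_sub_mul_le`, with the tail taken at the end of the time
interval). The kernel `κ + L r` has mass less than one on a short interval, so advancing by short
steps gives `w ≤ 0` (`nonpos_of_integral_mul_bump_le`). Then `w⁺ = 0`, and if `w(0) < 0` the
positive tail of `κ` makes the bound strict. The pair `(r, κ)` is explicit (`exists_isKernelPair`).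
-/

/-- The forward average `s ↦ ∫ h(q) ψ(s + q) dq` of `ψ` with weight `h`, the adjoint of the
convolution with `h`. -/
def forwardAverage (h ψ : ℝ → ℝ) (s : ℝ) : ℝ := ∫ q, h q * ψ (s + q)

theorem forwardAverage_eq_convolution (h ψ : ℝ → ℝ) :
    forwardAverage h ψ = (fun t => h (-t)) ⋆[ContinuousLinearMap.mul ℝ ℝ, volume] ψ := by
  funext s
  rw [forwardAverage, convolution_def, ← integral_neg_eq_self]
  simp [sub_eq_add_neg]

/-! ### Forward averages: regularity, support and mass. -/

section ForwardAverage

variable {h ψ : ℝ → ℝ} {b : ℝ}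

theorem continuous_forwardAverage (hh : Integrable h) (hψ : Continuous ψ)
    (hc : HasCompactSupport ψ) : Continuous (forwardAverage h ψ) := by
  rw [forwardAverage_eq_convolution]
  exact hc.continuous_convolution_right _ hh.comp_neg.locallyIntegrable hψ

theorem contDiff_forwardAverage (hh : Integrable h) (hψ : ContDiff ℝ ∞ ψ)
    (hc : HasCompactSupport ψ) : ContDiff ℝ ∞ (forwardAverage h ψ) := by
  rw [forwardAverage_eq_convolution]
  exact hc.contDiff_convolution_right _ hh.comp_neg.locallyIntegrable hψ

theorem deriv_forwardAverage (hh : Integrable h) (hψ : ContDiff ℝ ∞ ψ)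
    (hc : HasCompactSupport ψ) : deriv (forwardAverage h ψ) = forwardAverage h (deriv ψ) := by
  funext s
  rw [forwardAverage_eq_convolution, forwardAverage_eq_convolution]
  exact (hc.hasDerivAt_convolution_right _ hh.comp_neg.locallyIntegrable
    (hψ.of_le (by exact_mod_cast le_top)) s).deriv

theorem hasCompactSupport_forwardAverage (hh : HasCompactSupport h)
    (hc : HasCompactSupport ψ) : HasCompactSupport (forwardAverage h ψ) := by
  rw [forwardAverage_eq_convolution]
  exact (hh.comp_homeomorph (Homeomorph.neg ℝ)).convolution _ hc

theorem forwardAverage_eq_zero (hh : ∀ q ≤ 0, h q = 0) (hb : ∀ t, b ≤ t → ψ t = 0)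
    {s : ℝ} (hs : b ≤ s) : forwardAverage h ψ s = 0 := by
  refine integral_eq_zero_of_ae (Eventually.of_forall fun q => ?_)
  rcases le_total q 0 with hq | hq
  · simp [hh q hq]
  · simp [hb (s + q) (by linarith)]

theorem forwardAverage_nonneg (hh : ∀ q, 0 ≤ h q) (hψ : ∀ t, 0 ≤ ψ t) (s : ℝ) :
    0 ≤ forwardAverage h ψ s :=
  integral_nonneg fun q => mul_nonneg (hh q) (hψ _)

theorem integrable_mul_comp_add (hh : Integrable h) (hψ : Continuous ψ)
    (hc : HasCompactSupport ψ) (s : ℝ) : Integrable fun q => h q * ψ (s + q) := by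
  obtain ⟨C, hC⟩ := hc.exists_bound_of_continuous hψ
  exact hh.mul_bdd (c := C) (by fun_prop) (Eventually.of_forall fun q => hC _)

theorem forwardAverage_add_smul {h' : ℝ → ℝ} (hh : Integrable h) (hh' : Integrable h')
    (hψ : Continuous ψ) (hc : HasCompactSupport ψ) (L s : ℝ) :
    forwardAverage (fun q => h q + L * h' q) ψ s
      = forwardAverage h ψ s + L * forwardAverage h' ψ s := by
  simp only [forwardAverage]
  rw [← integral_const_mul, ← integral_add (integrable_mul_comp_add hh hψ hc s)
    ((integrable_mul_comp_add hh' hψ hc s).const_mul L)]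
  congr 1; ext q; ring

theorem integrable_prod_mul_comp_add (hh : Integrable h) (hψ : Continuous ψ)
    (hc : HasCompactSupport ψ) :
    Integrable fun p : ℝ × ℝ => h p.2 * ψ (p.1 + p.2) := by
  have h1 := hh.convolution_integrand (ContinuousLinearMap.mul ℝ ℝ) (μ := volume)
    ((hψ.integrable_of_hasCompactSupport hc).comp_neg)
  have e : (fun p : ℝ × ℝ => h p.2 * ψ (p.1 + p.2)) = (fun p : ℝ × ℝ =>
      (ContinuousLinearMap.mul ℝ ℝ) (h p.2) ((fun t => ψ (-t)) (p.1 - p.2)))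
      ∘ (Prod.map (fun x : ℝ => -x) id) := by
    ext p; simp [sub_eq_add_neg, add_comm]
  rw [e]
  exact (MeasurePreserving.integrable_comp_emb
    ((Measure.measurePreserving_neg volume).prod (MeasurePreserving.id volume))
    ((MeasurableEquiv.neg ℝ).prodCongr (MeasurableEquiv.refl ℝ)).measurableEmbedding).2 h1

/-- The forward average over `[a, ∞)` of a function supported in `(-∞, b)` only sees the mass of
the weight on `(-∞, b - a]`. -/
theorem setIntegral_forwardAverage_le (hh : Integrable h) (h0 : ∀ q, 0 ≤ h q)
    (hψ : Continuous ψ) (hc : HasCompactSupport ψ) (hψ0 : ∀ t, 0 ≤ ψ t)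
    (hb : ∀ t, b ≤ t → ψ t = 0) (a : ℝ) :
    IntegrableOn (forwardAverage h ψ) (Ici a) ∧
      ∫ s in Ici a, forwardAverage h ψ s ≤ (∫ q in Iic (b - a), h q) * ∫ t, ψ t := by
  have hI := integrable_prod_mul_comp_add hh hψ hc
  have hψi : Integrable ψ := hψ.integrable_of_hasCompactSupport hc
  have hI' : Integrable (fun p : ℝ × ℝ => h p.2 * ψ (p.1 + p.2))
      ((volume.restrict (Ici a)).prod volume) := by
    have := hI.integrableOn (s := Ici a ×ˢ univ)
    rwa [IntegrableOn, Measure.volume_eq_prod, ← Measure.prod_restrict,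
      Measure.restrict_univ] at this
  refine ⟨hI'.integral_prod_left, ?_⟩
  -- If `q > b - a` and `s ≥ a`, then `s + q > b` lies beyond the support of `ψ`.
  have hinner : ∀ q, ∫ s in Ici a, h q * ψ (s + q) ≤ (Iic (b - a)).indicator h q * ∫ t, ψ t := by
    intro q
    rw [integral_const_mul]
    by_cases hq : q ≤ b - a
    · rw [indicator_of_mem (by exact hq)]
      refine mul_le_mul_of_nonneg_left ?_ (h0 q)
      rw [← integral_add_right_eq_self ψ q]
      exact setIntegral_le_integral (hψi.comp_add_right q)
        (Eventually.of_forall fun s => hψ0 _)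
    · rw [indicator_of_notMem (by exact hq), zero_mul]
      push Not at hq
      rw [setIntegral_eq_zero_of_forall_eq_zero, mul_zero]
      intro s hs
      exact hb _ (by have : a ≤ s := hs; linarith)
  calc ∫ s in Ici a, forwardAverage h ψ s
      = ∫ q, ∫ s in Ici a, h q * ψ (s + q) := integral_integral_swap hI'
    _ ≤ ∫ q, (Iic (b - a)).indicator h q * ∫ t, ψ t := by
        refine integral_mono hI'.integral_prod_right ?_ hinner
        exact (hh.indicator measurableSet_Iic).mul_const _
    _ = _ := by rw [integral_mul_const, integral_indicator measurableSet_Iic]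

end ForwardAverage

/-- The adjoint of `S ↦ K * S'`, applied to the forward average of `ψ` with weight `r`, is
`ψ` minus its forward average with weight `κ`, when `κ` is a probability density with tails
`K * r`. -/
theorem neg_integral_mul_forwardAverage_deriv {K r κ ψ : ℝ → ℝ} {b : ℝ}
    (hK : ∀ R, IntegrableOn K (Iic R)) (hK0 : ∀ x < 0, K x = 0)
    (hr : Integrable r) (hr0 : ∀ x ≤ 0, r x = 0)
    (hκ : Integrable κ) (hκ0 : ∀ x ≤ 0, κ x = 0) (hκ1 : ∫ x, κ x = 1)
    (hKr : ∀ q > 0, ∫ x, K x * r (q - x) = ∫ p in Ioi q, κ p)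
    (hψ : ContDiff ℝ ∞ ψ) (hc : HasCompactSupport ψ) (hb : ∀ t, b ≤ t → ψ t = 0) (s : ℝ) :
    -∫ x, K x * forwardAverage r (deriv ψ) (x + s) = ψ s - forwardAverage κ ψ s := by
  have hd : Continuous (deriv ψ) := hψ.continuous_deriv (by exact_mod_cast le_top)
  have hdc : HasCompactSupport (deriv ψ) := hc.deriv
  have hb' : ∀ t, b < t → deriv ψ t = 0 := by
    intro t ht
    have : ψ =ᶠ[𝓝 t] fun _ => 0 := by
      filter_upwards [lt_mem_nhds ht] with u hu using hb u hu.le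
    rw [this.deriv_eq]; simp
  have hdi : Integrable (deriv ψ) := hd.integrable_of_hasCompactSupport hdc
  obtain ⟨C, hC⟩ := hdc.exists_bound_of_continuous hd
  -- `K` is integrable only on left half-lines. Truncating at `b - s` makes Fubini available and
  -- changes nothing, as the averaged derivative vanishes beyond `b`.
  set KR := (Iic (b - s)).indicator K with hKR
  have hKRi : Integrable KR := (hK (b - s)).integrable_indicator measurableSet_Iic
  have h1 : ∀ x, K x * forwardAverage r (deriv ψ) (x + s)
      = ∫ q, KR x * r (q - x) * deriv ψ (q + s) := by
    intro x
    have : ∫ q, KR x * r (q - x) * deriv ψ (q + s)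
        = KR x * forwardAverage r (deriv ψ) (x + s) := by
      rw [forwardAverage, ← integral_const_mul,
        ← integral_add_right_eq_self (fun q => KR x * r (q - x) * deriv ψ (q + s)) x]
      congr 1; ext q
      rw [add_sub_cancel_right, show q + x + s = x + s + q by ring, mul_assoc]
    rw [this]
    by_cases hx : x ≤ b - s
    · rw [hKR, indicator_of_mem (by exact hx)]
    · rw [hKR, indicator_of_notMem (by exact hx), zero_mul]
      push Not at hx
      rw [forwardAverage, integral_eq_zero_of_ae, mul_zero]
      refine Eventually.of_forall fun q => ?_
      rcases le_total q 0 with hq | hq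
      · simp [hr0 q hq]
      · simp [hb' (x + s + q) (by linarith)]
  have hI1 : Integrable (fun p : ℝ × ℝ => KR p.2 * r (p.1 - p.2) * deriv ψ (p.1 + s)) := by
    have := hKRi.convolution_integrand (ContinuousLinearMap.mul ℝ ℝ) (μ := volume) hr
    exact this.mul_bdd (c := C) (by fun_prop) (Eventually.of_forall fun q => hC _)
  -- The inner integral is `K * r` at `q`, hence the tail of `κ`. For `q > b - s`, where the
  -- truncation could be felt, the factor `deriv ψ (q + s)` is zero.
  have h2 : ∀ q, ∫ x, KR x * r (q - x) * deriv ψ (q + s)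
      = (Ioi (0 : ℝ)).indicator (fun q => ∫ p, (Ioi q).indicator κ p * deriv ψ (q + s)) q := by
    intro q
    rw [integral_mul_const]
    by_cases hq : 0 < q
    · rw [indicator_of_mem (by exact hq), integral_mul_const, integral_indicator measurableSet_Ioi,
        ← hKr q hq]
      by_cases hqb : q ≤ b - s
      · congr 2; ext x
        by_cases hx : x ≤ b - s
        · rw [hKR, indicator_of_mem (by exact hx)]
        · rw [hr0 (q - x) (by linarith), mul_zero, mul_zero]
      · rw [hb' (q + s) (by linarith), mul_zero, mul_zero]
    · rw [indicator_of_notMem (by exact hq), integral_eq_zero_of_ae, zero_mul]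
      refine Eventually.of_forall fun x => ?_
      rcases lt_or_ge x 0 with hx | hx
      · simp [hKR, indicator, hK0 x hx]
      · simp [hr0 (q - x) (by linarith)]
  have hI2 : Integrable (fun p : ℝ × ℝ => (Ioi p.1).indicator κ p.2 * deriv ψ (p.1 + s))
      ((volume.restrict (Ioi 0)).prod volume) := by
    have h0 : Integrable (fun p : ℝ × ℝ => deriv ψ (p.1 + s) * κ p.2)
        ((volume.restrict (Ioi 0)).prod volume) :=
      ((hdi.comp_add_right s).integrableOn (s := Ioi 0)).mul_prod hκ
    have hm : MeasurableSet {p : ℝ × ℝ | p.1 < p.2} := measurableSet_lt measurable_fst measurable_snd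
    refine (h0.indicator hm).congr (Eventually.of_forall fun p => ?_)
    by_cases hp : p.1 < p.2
    · simp [indicator, hp, mul_comm]
    · simp [indicator, hp]
  -- After the second exchange the constraint is `0 < q < p`, and the fundamental theorem of
  -- calculus applies.
  have h3 : ∀ p, ∫ q in Ioi 0, (Ioi q).indicator κ p * deriv ψ (q + s)
      = κ p * ψ (s + p) - κ p * ψ s := by
    intro p
    rcases le_or_gt p 0 with hp | hp
    · rw [hκ0 p hp, setIntegral_eq_zero_of_forall_eq_zero]
      · ring
      · intro q (hq : 0 < q)
        rw [indicator_of_notMem (by simp; linarith), zero_mul]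
    · have : ∀ q ∈ Ioi (0 : ℝ), (Ioi q).indicator κ p * deriv ψ (q + s)
          = (Iio p).indicator (fun q => κ p * deriv ψ (q + s)) q := by
        intro q _
        by_cases hqp : q < p <;> simp [indicator, hqp]
      rw [setIntegral_congr_fun measurableSet_Ioi this, setIntegral_indicator measurableSet_Iio,
        Ioi_inter_Iio, integral_const_mul, ← integral_Ioc_eq_integral_Ioo,
        ← intervalIntegral.integral_of_le hp.le,
        intervalIntegral.integral_comp_add_right (fun q => deriv ψ q) s,
        intervalIntegral.integral_deriv_eq_sub
          (fun x _ => (hψ.differentiable (by simp)).differentiableAt)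
          (hd.intervalIntegrable _ _), zero_add, add_comm p s]
      ring
  have hfin : ∫ x, K x * forwardAverage r (deriv ψ) (x + s)
      = forwardAverage κ ψ s - ψ s := by
    calc ∫ x, K x * forwardAverage r (deriv ψ) (x + s)
        = ∫ x, ∫ q, KR x * r (q - x) * deriv ψ (q + s) := integral_congr_ae
          (Eventually.of_forall h1)
      _ = ∫ q, ∫ x, KR x * r (q - x) * deriv ψ (q + s) := (integral_integral_swap hI1).symm
      _ = ∫ q in Ioi 0, ∫ p, (Ioi q).indicator κ p * deriv ψ (q + s) := by
          rw [← integral_indicator measurableSet_Ioi]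
          exact integral_congr_ae (Eventually.of_forall h2)
      _ = ∫ p, ∫ q in Ioi 0, (Ioi q).indicator κ p * deriv ψ (q + s) :=
          integral_integral_swap hI2
      _ = ∫ p, (κ p * ψ (s + p) - κ p * ψ s) := integral_congr_ae (Eventually.of_forall h3)
      _ = _ := by
          rw [integral_sub (integrable_mul_comp_add hκ hψ.continuous hc s) (hκ.mul_const _),
            integral_mul_const, hκ1, one_mul, forwardAverage]
  rw [hfin]; ring

/-! ### The Abel kernel as a distribution. -/

section AbelDistribution

theorem integrableOn_Iic_heavisidePow {β : ℝ} (hβ : -1 < β) (R : ℝ) :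
    IntegrableOn (heavisidePow β) (Iic R) := by
  have h1 : IntegrableOn (heavisidePow β) (Iio 0) := by
    refine integrableOn_zero.congr_fun (fun x hx => ?_) measurableSet_Iio
    simp [heavisidePow, not_le.2 (show x < 0 from hx)]
  have h2 : IntegrableOn (heavisidePow β) (Icc 0 (max R 0)) := by
    have := (intervalIntegral.intervalIntegrable_rpow' hβ (a := 0) (b := max R 0))
    rw [intervalIntegrable_iff_integrableOn_Icc_of_le (le_max_right _ _)] at this
    refine this.congr_fun (fun x hx => ?_) measurableSet_Icc
    simp [heavisidePow, hx.1]
  refine (h1.union h2).mono_set fun x hx => ?_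
  rcases lt_or_ge x 0 with h | h
  · exact Or.inl h
  · exact Or.inr ⟨h, le_max_of_le_left hx⟩

theorem abelDistribution_apply {β : ℝ} (hβ : -1 < β) (φ : 𝓓((⊤ : Opens ℝ), ℝ)) :
    abelDistribution β φ
      = -∫ x, (Real.Gamma (1 + β))⁻¹ * heavisidePow β x * deriv φ x := by
  have hloc : LocallyIntegrableOn (heavisidePow β) ((⊤ : Opens ℝ) : Set ℝ) := by
    intro x _
    exact ⟨Iic (x + 1), mem_nhdsWithin_of_mem_nhds (Iic_mem_nhds (by linarith)),
      integrableOn_Iic_heavisidePow hβ _⟩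
  have h1 : abelDistribution β φ = (Real.Gamma (1 + β))⁻¹ *
      TestFunction.integralAgainstBilinCLM (ContinuousLinearMap.mul ℝ ℝ) volume
        (heavisidePow β) (-∂_{(1 : ℝ)} φ) := by
    rw [abelDistribution]
    change _ * (∂_{(1 : ℝ)} (regularDistribution (heavisidePow β))) φ = _
    rw [Distribution.lineDerivOp_apply_apply]
    rfl
  rw [h1, TestFunction.integralAgainstBilinCLM_eq_integral hloc, ← integral_const_mul,
    ← integral_neg]
  congr 1; ext x
  have : (-∂_{(1 : ℝ)} φ) x = -deriv φ x := by
    change -((TestFunction.lineDerivCLM ℝ (1 : ℝ) φ : 𝓓((⊤ : Opens ℝ), ℝ)) x) = _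
    rw [TestFunction.lineDerivCLM_apply_of_le (by simp)]
    rw [lineDeriv]
    congr 1
    have := deriv_comp_const_add (f := φ) x 0
    simpa using this
  rw [this]
  simp only [ContinuousLinearMap.mul_apply']
  ring

end AbelDistribution

/-! ### Beta integrals and their scaling. -/

section BetaIntegrals

theorem intervalIntegrable_rpow_mul_one_sub_rpow {u v : ℝ} (hu : 0 < u) (hv : 0 < v) :
    IntervalIntegrable (fun x : ℝ => x ^ (u - 1) * (1 - x) ^ (v - 1)) volume 0 1 := by
  have h := Complex.betaIntegral_convergent (u := u) (v := v) (by simpa) (by simpa)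
  rw [intervalIntegrable_iff_integrableOn_Ioc_of_le zero_le_one] at h ⊢
  refine h.re.congr ?_
  filter_upwards [ae_restrict_mem measurableSet_Ioc] with x hx
  have h1 : (1 : ℂ) - x = ((1 - x : ℝ) : ℂ) := by push_cast; ring
  have h2 : (u : ℂ) - 1 = ((u - 1 : ℝ) : ℂ) := by push_cast; ring
  have h3 : (v : ℂ) - 1 = ((v - 1 : ℝ) : ℂ) := by push_cast; ring
  rw [h1, h2, h3, ← Complex.ofReal_cpow hx.1.le, ← Complex.ofReal_cpow (by linarith [hx.2]),
    ← Complex.ofReal_mul]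
  exact Complex.ofReal_re _

theorem integral_rpow_mul_one_sub_rpow_pos {u v : ℝ} (hu : 0 < u) (hv : 0 < v) :
    0 < ∫ x : ℝ in 0..1, x ^ (u - 1) * (1 - x) ^ (v - 1) := by
  refine intervalIntegral.intervalIntegral_pos_of_pos_on
    (intervalIntegrable_rpow_mul_one_sub_rpow hu hv) (fun x hx => ?_) zero_lt_one
  exact mul_pos (Real.rpow_pos_of_pos hx.1 _) (Real.rpow_pos_of_pos (by linarith [hx.2]) _)

theorem rpow_mul_sub_rpow_scale {u v q : ℝ} (hq : 0 < q) {x : ℝ} (hx : x ∈ Ioo 0 q) :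
    x ^ (u - 1) * (q - x) ^ (v - 1)
      = q ^ (u + v - 2) * ((q⁻¹ * x) ^ (u - 1) * (1 - q⁻¹ * x) ^ (v - 1)) := by
  have h1 : x = q * (q⁻¹ * x) := by field_simp
  have h2 : q - x = q * (1 - q⁻¹ * x) := by field_simp
  have h3 : 0 ≤ q⁻¹ * x := mul_nonneg (inv_nonneg.2 hq.le) hx.1.le
  have h4 : 0 ≤ 1 - q⁻¹ * x := by
    have : 0 ≤ q * (1 - q⁻¹ * x) := by rw [← h2]; linarith [hx.2]
    exact nonneg_of_mul_nonneg_right this hq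
  rw [h2]
  nth_rewrite 1 [h1]
  rw [Real.mul_rpow hq.le h3, Real.mul_rpow hq.le h4,
    show u + v - 2 = (u - 1) + (v - 1) by ring, Real.rpow_add hq]
  ring

theorem integrableOn_rpow_mul_sub_rpow {u v q : ℝ} (hu : 0 < u) (hv : 0 < v) (hq : 0 < q) :
    IntegrableOn (fun x : ℝ => x ^ (u - 1) * (q - x) ^ (v - 1)) (Ioo 0 q) := by
  have h := (intervalIntegrable_rpow_mul_one_sub_rpow hu hv).comp_mul_left (c := q⁻¹)
  simp only [zero_div, one_div, inv_inv] at h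
  rw [intervalIntegrable_iff_integrableOn_Ioo_of_le hq.le] at h
  exact IntegrableOn.congr_fun (h.const_mul (q ^ (u + v - 2)))
    (fun x hx => (rpow_mul_sub_rpow_scale hq hx).symm) measurableSet_Ioo

theorem setIntegral_rpow_mul_sub_rpow {u v q : ℝ} (hq : 0 < q) :
    ∫ x in Ioo 0 q, x ^ (u - 1) * (q - x) ^ (v - 1)
      = q ^ (u + v - 1) * ∫ x : ℝ in 0..1, x ^ (u - 1) * (1 - x) ^ (v - 1) := by
  rw [setIntegral_congr_fun measurableSet_Ioo fun x hx => rpow_mul_sub_rpow_scale hq hx,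
    integral_const_mul, ← integral_Ioc_eq_integral_Ioo,
    ← intervalIntegral.integral_of_le hq.le,
    intervalIntegral.integral_comp_mul_left
      (fun x => x ^ (u - 1) * (1 - x) ^ (v - 1)) (inv_ne_zero hq.ne')]
  simp only [mul_zero, inv_mul_cancel₀ hq.ne', inv_inv, smul_eq_mul]
  rw [← mul_assoc, ← Real.rpow_add_one hq.ne']
  congr 2; ring

end BetaIntegrals

/-- Nonnegative integrable kernels `r` and `κ` on `(0, ∞)` such that `κ` is a probability density
with positive tails `K * r`, dominating `L r`. -/
structure IsKernelPair (K : ℝ → ℝ) (L : ℝ) (r κ : ℝ → ℝ) : Prop where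
  nonneg : ∀ x, 0 ≤ r x
  zero_of_nonpos : ∀ x ≤ 0, r x = 0
  hasCompactSupport : HasCompactSupport r
  integrable : Integrable r
  mul_le : ∀ x, L * r x ≤ κ x
  density_zero_of_nonpos : ∀ x ≤ 0, κ x = 0
  density_integrable : Integrable κ
  density_integral : ∫ x, κ x = 1
  tail_pos : ∀ q > 0, 0 < ∫ p in Ioi q, κ p
  integral_mul_eq_tail : ∀ q > 0, ∫ x, K x * r (q - x) = ∫ p in Ioi q, κ p

/-! ### The truncated two-term kernel and its convolution with a power. -/

section TruncatedKernel

/-- The kernel `a x ^ (α - 1) - b x ^ (2 α - 1)`, cut off outside `(0, δ)`. -/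
def truncatedKernel (α a b δ : ℝ) : ℝ → ℝ :=
  (Ioo 0 δ).indicator fun x => a * x ^ (α - 1) - b * x ^ (2 * α - 1)

/-- The density `d x ^ (α - 1)` on `(0, δ]`, continued beyond `δ` by minus the derivative of the
convolution of `c x ^ (-α)` with `r`. -/
def tailDensity (α c d δ : ℝ) (r : ℝ → ℝ) : ℝ → ℝ := fun q =>
  (Ioc 0 δ).indicator (fun x => d * x ^ (α - 1)) q
    + (Ioi δ).indicator (fun q => ∫ s in Ioo 0 δ, α * (q - s) ^ (-α - 1) * (c * r s)) q

variable {α a b c d δ : ℝ}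

theorem measurable_truncatedKernel : Measurable (truncatedKernel α a b δ) :=
  Measurable.indicator (by fun_prop) measurableSet_Ioo

theorem truncatedKernel_pos (hα : 0 < α) (hb : 0 < b) (hδ : b * δ ^ α ≤ a) {x : ℝ}
    (hx : x ∈ Ioo 0 δ) : 0 < truncatedKernel α a b δ x := by
  rw [truncatedKernel, indicator_of_mem hx, show 2 * α - 1 = α - 1 + α by ring,
    Real.rpow_add hx.1]
  have h1 := Real.rpow_pos_of_pos hx.1 (α - 1)
  have h2 : b * x ^ α < b * δ ^ α :=
    mul_lt_mul_of_pos_left (Real.rpow_lt_rpow hx.1.le hx.2 hα) hb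
  nlinarith

theorem truncatedKernel_nonneg (hα : 0 < α) (hb : 0 < b) (hδ : b * δ ^ α ≤ a) (x : ℝ) :
    0 ≤ truncatedKernel α a b δ x := by
  by_cases hx : x ∈ Ioo 0 δ
  · exact (truncatedKernel_pos hα hb hδ hx).le
  · rw [truncatedKernel, indicator_of_notMem hx]

theorem truncatedKernel_le (hb : 0 < b) {x : ℝ} (hx : x ∈ Ioo 0 δ) :
    truncatedKernel α a b δ x ≤ a * x ^ (α - 1) := by
  rw [truncatedKernel, indicator_of_mem hx]
  have := mul_pos hb (Real.rpow_pos_of_pos hx.1 (2 * α - 1))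
  linarith

theorem integrable_truncatedKernel (hα : 0 < α) : Integrable (truncatedKernel α a b δ) := by
  rcases le_or_gt δ 0 with hδ | hδ
  · rw [truncatedKernel, Ioo_eq_empty (by linarith), indicator_empty]
    exact integrable_zero _ _ _
  have h (β : ℝ) (hβ : 0 < β) : IntegrableOn (fun x : ℝ => x ^ (β - 1)) (Ioo 0 δ) := by
    rw [← intervalIntegrable_iff_integrableOn_Ioo_of_le hδ.le]
    exact intervalIntegral.intervalIntegrable_rpow' (by linarith)
  rw [truncatedKernel, integrable_indicator_iff measurableSet_Ioo]
  exact ((h α hα).const_mul a).sub ((h (2 * α) (by linarith)).const_mul b)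

/-- By beta scaling, convolution with `x ^ (-α)` sends `x ^ (α - 1)` to a constant and `x ^ (2 * α -
1)` to a multiple of `q ^ α`. Up to `δ` the cutoff is not felt. -/
theorem integrableOn_rpow_mul_truncatedKernel (hα₀ : 0 < α) (hα₁ : α < 1) {q : ℝ} (hq : 0 < q)
    (hqδ : q ≤ δ) :
    IntegrableOn (fun s => (q - s) ^ (-α) * (c * truncatedKernel α a b δ s)) (Ioo 0 q) ∧
      ∫ s in Ioo 0 q, (q - s) ^ (-α) * (c * truncatedKernel α a b δ s)
        = c * a * (∫ x : ℝ in 0..1, x ^ (α - 1) * (1 - x) ^ (1 - α - 1))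
          - c * b * (∫ x : ℝ in 0..1, x ^ (2 * α - 1) * (1 - x) ^ (1 - α - 1)) * q ^ α := by
  have e : EqOn (fun s => c * a * (s ^ (α - 1) * (q - s) ^ (1 - α - 1))
      - c * b * (s ^ (2 * α - 1) * (q - s) ^ (1 - α - 1)))
      (fun s => (q - s) ^ (-α) * (c * truncatedKernel α a b δ s)) (Ioo 0 q) := by
    intro s hs
    simp only [truncatedKernel]
    rw [indicator_of_mem (show s ∈ Ioo 0 δ from ⟨hs.1, hs.2.trans_le hqδ⟩),
      show 1 - α - 1 = -α by ring]
    ring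
  have h1 := integrableOn_rpow_mul_sub_rpow hα₀ (sub_pos.2 hα₁) hq
  have h2 := integrableOn_rpow_mul_sub_rpow (u := 2 * α) (by linarith) (sub_pos.2 hα₁) hq
  refine ⟨IntegrableOn.congr_fun ((h1.const_mul _).sub (h2.const_mul _)) e measurableSet_Ioo, ?_⟩
  rw [← setIntegral_congr_fun measurableSet_Ioo e,
    integral_sub (h1.const_mul _) (h2.const_mul _), integral_const_mul, integral_const_mul,
    setIntegral_rpow_mul_sub_rpow hq, setIntegral_rpow_mul_sub_rpow hq,
    show α + (1 - α) - 1 = 0 by ring, show 2 * α + (1 - α) - 1 = α by ring, Real.rpow_zero]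
  ring

theorem integrableOn_rpow_mul_of_le {r : ℝ → ℝ} (hα : 0 < α) (hr : Measurable r)
    (hi : IntegrableOn (fun s => (δ - s) ^ (-α) * r s) (Ioo 0 δ)) {q : ℝ} (hq : δ ≤ q) :
    IntegrableOn (fun s => (q - s) ^ (-α) * r s) (Ioo 0 δ) := by
  refine Integrable.mono hi (by fun_prop) ?_
  filter_upwards [ae_restrict_mem measurableSet_Ioo] with s hs
  rw [norm_mul, norm_mul]
  refine mul_le_mul_of_nonneg_right ?_ (norm_nonneg _)
  have h1 : 0 < δ - s := by linarith [hs.2]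
  rw [Real.norm_of_nonneg (Real.rpow_nonneg h1.le _),
    Real.norm_of_nonneg (Real.rpow_nonneg (by linarith) _)]
  exact Real.rpow_le_rpow_of_nonpos h1 (by linarith) (by linarith)

theorem integral_Ioi_sub_rpow (hα : 0 < α) {q s : ℝ} (hs : s < q) :
    IntegrableOn (fun p => α * (p - s) ^ (-α - 1)) (Ioi q) ∧
      ∫ p in Ioi q, α * (p - s) ^ (-α - 1) = (q - s) ^ (-α) := by
  have h := integrableOn_add_rpow_Ioi_of_lt (a := -α - 1) (c := q) (m := -s) (by linarith)
    (by linarith)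
  simp only [← sub_eq_add_neg] at h
  refine ⟨h.const_mul α, ?_⟩
  rw [integral_const_mul]
  have h2 : ∫ p in Ioi q, (p - s) ^ (-α - 1) = ∫ p in Ioi (q - s), p ^ (-α - 1) := by
    rw [← integral_indicator measurableSet_Ioi, ← integral_indicator measurableSet_Ioi,
      ← integral_sub_right_eq_self ((Ioi (q - s)).indicator _) s]
    congr 1; ext p
    simp [indicator]
  rw [h2, integral_Ioi_rpow_of_lt (by linarith) (by linarith)]
  have : -α - 1 + 1 = -α := by ring
  rw [this]
  field_simp

/-- The tails of the function `q ↦ ∫ α (q - s) ^ (-α - 1) r(s) ds` beyond the support of `r`. -/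
theorem integral_Ioi_integral_rpow {r : ℝ → ℝ} (hα : 0 < α) (hr : Measurable r)
    (hr0 : ∀ s, 0 ≤ r s)
    (hi : IntegrableOn (fun s => (δ - s) ^ (-α) * r s) (Ioo 0 δ)) {q : ℝ} (hq : δ ≤ q) :
    IntegrableOn (fun p => ∫ s in Ioo 0 δ, α * (p - s) ^ (-α - 1) * r s) (Ioi q) ∧
      ∫ p in Ioi q, ∫ s in Ioo 0 δ, α * (p - s) ^ (-α - 1) * r s
        = ∫ s in Ioo 0 δ, (q - s) ^ (-α) * r s := by
  have hint : ∀ s ∈ Ioo 0 δ, ∫ p in Ioi q, α * (p - s) ^ (-α - 1) * r s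
      = (q - s) ^ (-α) * r s := by
    intro s hs
    rw [integral_mul_const, (integral_Ioi_sub_rpow hα (hs.2.trans_le hq)).2]
  have hI : Integrable (fun z : ℝ × ℝ => α * (z.2 - z.1) ^ (-α - 1) * r z.1)
      ((volume.restrict (Ioo 0 δ)).prod (volume.restrict (Ioi q))) := by
    rw [integrable_prod_iff (by fun_prop)]
    constructor
    · filter_upwards [ae_restrict_mem measurableSet_Ioo] with s hs
      exact (integral_Ioi_sub_rpow hα (hs.2.trans_le hq)).1.mul_const _
    · refine (integrableOn_rpow_mul_of_le hα hr hi hq).congr_fun (fun s hs => ?_)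
        measurableSet_Ioo
      refine (hint s hs).symm.trans ?_
      refine setIntegral_congr_fun measurableSet_Ioi fun p (hp : q < p) => ?_
      have h1 : 0 ≤ (p - s) ^ (-α - 1) := Real.rpow_nonneg (by linarith [hs.2]) _
      exact (Real.norm_of_nonneg (mul_nonneg (mul_nonneg hα.le h1) (hr0 s))).symm
  refine ⟨hI.integral_prod_right, ?_⟩
  rw [← integral_integral_swap hI]
  exact setIntegral_congr_fun measurableSet_Ioo hint

end TruncatedKernel

/-! ### Tails of the density and existence of kernel pairs. -/

section KernelPair

variable {α a b c d δ : ℝ} {r : ℝ → ℝ}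

theorem tailDensity_of_nonpos (hδ : 0 < δ) {x : ℝ} (hx : x ≤ 0) :
    tailDensity α c d δ r x = 0 := by
  rw [tailDensity, indicator_of_notMem (fun h => (h.1.trans_le hx).false),
    indicator_of_notMem (fun h : x ∈ Ioi δ => by linarith [mem_Ioi.1 h]), add_zero]

theorem tailDensity_of_mem {x : ℝ} (hx : x ∈ Ioc 0 δ) :
    tailDensity α c d δ r x = d * x ^ (α - 1) := by
  rw [tailDensity, indicator_of_mem hx,
    indicator_of_notMem (fun h : x ∈ Ioi δ => by linarith [mem_Ioi.1 h, hx.2]), add_zero]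

theorem tailDensity_of_gt {x : ℝ} (hx : δ < x) :
    tailDensity α c d δ r x = ∫ s in Ioo 0 δ, α * (x - s) ^ (-α - 1) * (c * r s) := by
  rw [tailDensity, indicator_of_notMem (fun h => by linarith [h.2]),
    indicator_of_mem (show x ∈ Ioi δ from hx), zero_add]

theorem tailDensity_nonneg (hα : 0 < α) (hc : 0 < c) (hd : 0 ≤ d) (hδ : 0 < δ)
    (hr0 : ∀ s, 0 ≤ r s) (x : ℝ) : 0 ≤ tailDensity α c d δ r x := by
  rcases le_or_gt x 0 with hx | hx
  · rw [tailDensity_of_nonpos hδ hx]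
  rcases le_or_gt x δ with hx' | hx'
  · rw [tailDensity_of_mem ⟨hx, hx'⟩]
    exact mul_nonneg hd (Real.rpow_nonneg hx.le _)
  · rw [tailDensity_of_gt hx']
    refine setIntegral_nonneg measurableSet_Ioo fun s hs => ?_
    exact mul_nonneg (mul_nonneg hα.le (Real.rpow_nonneg (by linarith [hs.2]) _))
      (mul_nonneg hc.le (hr0 s))

theorem tailDensity_tail_of_ge (hα : 0 < α) (hc : 0 < c) (hr : Measurable r)
    (hr0 : ∀ s, 0 ≤ r s)
    (hi : IntegrableOn (fun s => (δ - s) ^ (-α) * (c * r s)) (Ioo 0 δ)) {q : ℝ} (hq : δ ≤ q) :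
    IntegrableOn (tailDensity α c d δ r) (Ioi q) ∧
      ∫ p in Ioi q, tailDensity α c d δ r p = ∫ s in Ioo 0 δ, (q - s) ^ (-α) * (c * r s) := by
  have h := integral_Ioi_integral_rpow hα (hr.const_mul c)
    (fun s => mul_nonneg hc.le (hr0 s)) hi hq
  have e : EqOn (fun p => ∫ s in Ioo 0 δ, α * (p - s) ^ (-α - 1) * (c * r s))
      (tailDensity α c d δ r) (Ioi q) := fun p hp =>
    (tailDensity_of_gt (hq.trans_lt hp)).symm
  exact ⟨h.1.congr_fun e measurableSet_Ioi, by
    rw [← h.2, setIntegral_congr_fun measurableSet_Ioi e]⟩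

theorem tailDensity_tail_of_le (hα : 0 < α) (hc : 0 < c) (hr : Measurable r)
    (hr0 : ∀ s, 0 ≤ r s)
    (hi : IntegrableOn (fun s => (δ - s) ^ (-α) * (c * r s)) (Ioo 0 δ)) {q : ℝ} (hq0 : 0 ≤ q)
    (hq : q ≤ δ) :
    IntegrableOn (tailDensity α c d δ r) (Ioi q) ∧
      ∫ p in Ioi q, tailDensity α c d δ r p
        = d / α * (δ ^ α - q ^ α) + ∫ s in Ioo 0 δ, (δ - s) ^ (-α) * (c * r s) := by
  obtain ⟨h1, h2⟩ := tailDensity_tail_of_ge (d := d) hα hc hr hr0 hi le_rfl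
  have e : EqOn (fun x => d * x ^ (α - 1)) (tailDensity α c d δ r) (Ioc q δ) := fun x hx =>
    (tailDensity_of_mem ⟨hq0.trans_lt hx.1, hx.2⟩).symm
  have h3 : IntegrableOn (fun x : ℝ => d * x ^ (α - 1)) (Ioc q δ) := by
    rw [← intervalIntegrable_iff_integrableOn_Ioc_of_le hq]
    exact (intervalIntegral.intervalIntegrable_rpow' (by linarith)).const_mul d
  have h4 := h3.congr_fun e measurableSet_Ioc
  rw [← Ioc_union_Ioi_eq_Ioi hq]
  refine ⟨h4.union h1, ?_⟩
  rw [setIntegral_union Ioc_disjoint_Ioi_same measurableSet_Ioi h4 h1, h2,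
    ← setIntegral_congr_fun measurableSet_Ioc e, ← intervalIntegral.integral_of_le hq,
    intervalIntegral.integral_const_mul, integral_rpow (Or.inl (by linarith))]
  have : α - 1 + 1 = α := by ring
  rw [this]
  ring

theorem integral_heavisidePow_mul_truncatedKernel {q : ℝ} :
    ∫ x, c * heavisidePow (-α) x * truncatedKernel α a b δ (q - x)
      = ∫ s in Ioo 0 (min q δ), (q - s) ^ (-α) * (c * truncatedKernel α a b δ s) := by
  rw [← integral_sub_left_eq_self _ volume q, ← integral_indicator measurableSet_Ioo]
  refine integral_congr_ae ?_
  -- At `s = q` the Heaviside factor is already switched on while the open interval may exclude the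
  -- point, so it is discarded as a null set.
  filter_upwards [compl_mem_ae_iff.2 (measure_singleton (μ := volume) q)] with s hs
  have hs' : s ≠ q := hs
  rw [sub_sub_cancel]
  by_cases hsm : s ∈ Ioo 0 (min q δ)
  · rw [indicator_of_mem hsm, heavisidePow, if_pos (by linarith [hsm.2, min_le_left q δ])]
    ring
  · rw [indicator_of_notMem hsm]
    by_cases hsδ : s ∈ Ioo 0 δ
    · have : ¬ 0 ≤ q - s := fun h => hsm ⟨hsδ.1, lt_min
        (lt_of_le_of_ne (by linarith) hs') hsδ.2⟩
      rw [heavisidePow, if_neg this]; ring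
    · rw [truncatedKernel, indicator_of_notMem hsδ, mul_zero]

/-- Two power terms suffice. On `(0, δ]` the convolution is `1 - (L a / α) q ^ α`, which decreases
at rate `L a q ^ (α - 1) ≥ L r(q)`. Beyond `δ` the kernel `r` vanishes, so `κ` only has to be
nonnegative there, and it is, because `q ↦ (q - s) ^ (-α)` decreases. -/
theorem exists_isKernelPair (hα₀ : 0 < α) (hα₁ : α < 1) (hc : 0 < c) {L : ℝ} (hL : 0 < L) :
    ∃ r κ, IsKernelPair (fun x => c * heavisidePow (-α) x) L r κ := by
  have hB₁ := integral_rpow_mul_one_sub_rpow_pos hα₀ (sub_pos.2 hα₁)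
  have hB₂ := integral_rpow_mul_one_sub_rpow_pos (u := 2 * α) (by linarith) (sub_pos.2 hα₁)
  set B₁ := ∫ x : ℝ in 0..1, x ^ (α - 1) * (1 - x) ^ (1 - α - 1) with hB₁_def
  set B₂ := ∫ x : ℝ in 0..1, x ^ (2 * α - 1) * (1 - x) ^ (1 - α - 1) with hB₂_def
  -- `a` normalizes the total mass of `κ`, `b` matches the decrease of the convolution with the
  -- density `L a q ^ (α - 1)`, and `δ` is the zero of `a - b x ^ α`, up to which `r` is
  -- nonnegative.
  obtain ⟨a, ha, haB⟩ : ∃ a, 0 < a ∧ c * a * B₁ = 1 :=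
    ⟨1 / (c * B₁), by positivity, by field_simp⟩
  obtain ⟨b, hb, hbB⟩ : ∃ b, 0 < b ∧ L * a / α = c * b * B₂ :=
    ⟨L * a / (α * c * B₂), by positivity, by field_simp⟩
  obtain ⟨δ, hδ, hδb⟩ : ∃ δ, 0 < δ ∧ b * δ ^ α ≤ a := by
    refine ⟨(a / b) ^ α⁻¹, by positivity, ?_⟩
    rw [Real.rpow_inv_rpow (by positivity) hα₀.ne']
    exact (mul_div_cancel₀ a hb.ne').le
  have hr0 := truncatedKernel_nonneg (a := a) hα₀ hb hδb
  have hrm : Measurable (truncatedKernel α a b δ) := measurable_truncatedKernel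
  obtain ⟨hi, hδint⟩ := integrableOn_rpow_mul_truncatedKernel (a := a) (b := b) (c := c)
    hα₀ hα₁ hδ le_rfl
  set r := truncatedKernel α a b δ with hr_def
  set κ := tailDensity α c (L * a) δ r with hκ_def
  have hκ0 : ∀ x ≤ 0, κ x = 0 := fun x hx => tailDensity_of_nonpos hδ hx
  have hκnn : ∀ x, 0 ≤ κ x := tailDensity_nonneg hα₀ hc (by positivity) hδ hr0
  have htail : ∀ q, 0 ≤ q → q ≤ δ → IntegrableOn κ (Ioi q) ∧
      ∫ p in Ioi q, κ p = 1 - c * b * B₂ * q ^ α := by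
    intro q h0 h1
    have h := tailDensity_tail_of_le (d := L * a) hα₀ hc hrm hr0 hi h0 h1
    refine ⟨h.1, h.2.trans ?_⟩
    rw [hδint, hbB, haB]
    ring
  have hκi : Integrable κ := by
    rw [← integrableOn_univ, ← Iic_union_Ioi (a := (0 : ℝ))]
    refine IntegrableOn.union ?_ (htail 0 le_rfl hδ.le).1
    exact integrableOn_zero.congr_fun (fun x hx => (hκ0 x hx).symm) measurableSet_Iic
  have hge : ∀ q, δ ≤ q → ∫ p in Ioi q, κ p = ∫ s in Ioo 0 δ, (q - s) ^ (-α) * (c * r s) :=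
    fun q hq => (tailDensity_tail_of_ge hα₀ hc hrm hr0 hi hq).2
  have hpos : ∀ q, δ ≤ q → 0 < ∫ p in Ioi q, κ p := by
    intro q hq
    rw [hge q hq, ← integral_Ioc_eq_integral_Ioo, ← intervalIntegral.integral_of_le hδ.le]
    refine intervalIntegral.intervalIntegral_pos_of_pos_on ?_ (fun s hs => ?_) hδ
    · rw [intervalIntegrable_iff_integrableOn_Ioo_of_le hδ.le]
      exact integrableOn_rpow_mul_of_le hα₀ (hrm.const_mul c) hi hq
    · exact mul_pos (Real.rpow_pos_of_pos (by linarith [hs.2]) _)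
        (mul_pos hc (truncatedKernel_pos hα₀ hb hδb hs))
  refine ⟨r, κ, hr0, ?_, ?_, integrable_truncatedKernel hα₀, ?_, hκ0, hκi, ?_, ?_, ?_⟩
  · intro x hx
    exact indicator_of_notMem (fun h => (h.1.trans_le hx).false) _
  · refine HasCompactSupport.intro (isCompact_Icc (a := 0) (b := δ)) fun x hx => ?_
    exact indicator_of_notMem (fun h => hx (Ioo_subset_Icc_self h)) _
  · intro x
    by_cases hx : x ∈ Ioo 0 δ
    · rw [hκ_def, tailDensity_of_mem ⟨hx.1, hx.2.le⟩, mul_assoc]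
      exact mul_le_mul_of_nonneg_left (truncatedKernel_le hb hx) hL.le
    · rw [hr_def, truncatedKernel, indicator_of_notMem hx, mul_zero]
      exact hκnn x
  · rw [← setIntegral_eq_integral_of_forall_compl_eq_zero (s := Ioi 0)
      (fun x hx => hκ0 x (not_lt.1 hx)), (htail 0 le_rfl hδ.le).2, Real.zero_rpow hα₀.ne']
    ring
  · intro q _
    -- Tails decrease in `q`, and from `δ` on they are integrals of a positive function.
    refine (hpos (max q δ) (le_max_right _ _)).trans_le ?_
    exact setIntegral_mono_set hκi.integrableOn (Eventually.of_forall hκnn)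
      (Ioi_subset_Ioi (le_max_left _ _)).eventuallyLE
  · intro q hq
    rw [hr_def, integral_heavisidePow_mul_truncatedKernel]
    rcases le_total q δ with h | h
    · rw [min_eq_left h, (integrableOn_rpow_mul_truncatedKernel hα₀ hα₁ hq h).2,
        (htail q hq.le h).2, ← hB₁_def, ← hB₂_def, haB]
    · rw [min_eq_right h, hge q h]

end KernelPair

/-! ### Lipschitz bound along two trajectories, and testing with bumps. -/

/-- By compactness of `[0, b]` a local bound is enough. Where the trajectories meet, it is the local
Lipschitz hypothesis. Where they differ, `|z - y|` stays away from zero nearby and continuity of `f`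
bounds the quotient. -/
theorem exists_pos_lipschitz_along {f : ℝ → ℝ → ℝ} {y z : ℝ → ℝ} {b : ℝ}
    (hf : ContinuousOn (fun p : ℝ × ℝ => f p.1 p.2) (Ici 0 ×ˢ univ))
    (hfLip : LocallyLipschitzInState f)
    (hy : ContinuousOn y (Icc 0 b)) (hz : ContinuousOn z (Icc 0 b)) :
    ∃ L > 0, ∀ s ∈ Icc 0 b, |f s (z s) - f s (y s)| ≤ L * |z s - y s| := by
  suffices h : ∃ L : ℝ, ∀ s ∈ Icc 0 b, |f s (z s) - f s (y s)| ≤ L * |z s - y s| by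
    obtain ⟨L, hL⟩ := h
    exact ⟨max L 1, by positivity, fun s hs => (hL s hs).trans
      (mul_le_mul_of_nonneg_right (le_max_left _ _) (abs_nonneg _))⟩
  refine isCompact_Icc.induction_on
    (p := fun S => ∃ L : ℝ, ∀ s ∈ S, |f s (z s) - f s (y s)| ≤ L * |z s - y s|) ?_ ?_ ?_ ?_
  · exact ⟨0, by simp⟩
  · rintro S S' hSS ⟨L, hL⟩
    exact ⟨L, fun s hs => hL s (hSS hs)⟩
  · rintro S S' ⟨L, hL⟩ ⟨L', hL'⟩
    refine ⟨max L L', fun s hs => ?_⟩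
    rcases hs with hs | hs
    · exact (hL s hs).trans (mul_le_mul_of_nonneg_right (le_max_left _ _) (abs_nonneg _))
    · exact (hL' s hs).trans (mul_le_mul_of_nonneg_right (le_max_right _ _) (abs_nonneg _))
  · intro x hx
    have hyx := hy x hx
    have hzx := hz x hx
    have hmono : 𝓝[Icc 0 b] x ≤ 𝓝[Ici 0] x := nhdsWithin_mono _ Icc_subset_Ici_self
    by_cases hyz : y x = z x
    · obtain ⟨L, N, hN, hLN⟩ := hfLip x hx.1 (y x)
      refine ⟨_, (hLN.filter_mono hmono).and
        ((hyx.eventually hN).and (hzx.eventually (hyz ▸ hN))), L, fun s hs => ?_⟩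
      simpa [Real.dist_eq] using hs.1.dist_le_mul _ hs.2.2 _ hs.2.1
    · have hpos : 0 < |z x - y x| := abs_pos.2 (sub_ne_zero.2 (Ne.symm hyz))
      have hcomp {u : ℝ → ℝ} (hu : ContinuousWithinAt u (Icc 0 b) x) :
          ContinuousWithinAt (fun s => f s (u s)) (Icc 0 b) x :=
        ContinuousWithinAt.comp (f := fun s => (s, u s)) (hf (x, u x) ⟨hx.1, mem_univ _⟩)
          (continuousWithinAt_id.prodMk hu) fun s hs => ⟨hs.1, mem_univ _⟩
      have h1 := ((hcomp hzx).sub (hcomp hyx)).abs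
      have h2 := (hzx.sub hyx).abs
      set M := |f x (z x) - f x (y x)| + 1
      refine ⟨_, (h1.eventually_lt_const (u := M) (by simp [M])).and
        (h2.eventually_const_lt (u := |z x - y x| / 2) (by simpa using hpos)),
        M / (|z x - y x| / 2), fun s hs => ?_⟩
      have hs1 : |f s (z s) - f s (y s)| < M := hs.1
      have hs2 : |z x - y x| / 2 < |z s - y s| := hs.2
      have hM : 0 < M := by positivity
      rw [div_mul_eq_mul_div, le_div_iff₀ (by positivity)]
      nlinarith [abs_nonneg (f s (z s) - f s (y s))]

theorem integrableOn_Ici_mul {v g : ℝ → ℝ} {b : ℝ} (hv : ContinuousOn v (Icc 0 b))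
    (hg : Continuous g) (hb : ∀ t, b ≤ t → g t = 0) :
    IntegrableOn (fun s => v s * g s) (Ici 0) := by
  have h1 : IntegrableOn (fun s => v s * g s) (Icc 0 b) :=
    (hv.mul hg.continuousOn).integrableOn_Icc
  have h2 : IntegrableOn (fun s => v s * g s) (Ici b) :=
    integrableOn_zero.congr_fun (fun s hs => by simp [hb s hs]) measurableSet_Ici
  refine (h1.union h2).mono_set fun x hx => ?_
  rcases le_total x b with h | h
  · exact Or.inl ⟨hx, h⟩
  · exact Or.inr h

/-- Smooth, nonnegative functions with compact support in time, vanishing outside `(a, b)`. -/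
structure IsBump (a b : ℝ) (ψ : ℝ → ℝ) : Prop where
  contDiff : ContDiff ℝ ∞ ψ
  hasCompactSupport : HasCompactSupport ψ
  nonneg : ∀ t, 0 ≤ ψ t
  zero_of_le : ∀ t ≤ a, ψ t = 0
  zero_of_ge : ∀ t, b ≤ t → ψ t = 0

theorem IsBump.integrable {a b : ℝ} {ψ : ℝ → ℝ} (hψ : IsBump a b ψ) : Integrable ψ :=
  hψ.contDiff.continuous.integrable_of_hasCompactSupport hψ.hasCompactSupport

/-- Returns from weak to pointwise bounds: if `w` exceeded `C` at a point, a bump concentrated near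
it would violate the hypothesis. -/
theorem le_of_integral_mul_bump_le {w : ℝ → ℝ} {a b C : ℝ} (ha : 0 ≤ a)
    (hw : ContinuousOn w (Icc 0 b))
    (h : ∀ ψ, IsBump a b ψ → ∫ s in Ici 0, w s * ψ s ≤ C * ∫ t, ψ t) :
    ∀ t ∈ Ioo a b, w t ≤ C := by
  intro t ht
  by_contra! hlt
  obtain ⟨C', hC, hC'⟩ := exists_between hlt
  have hnhds : Ioo a b ∈ 𝓝 t := Ioo_mem_nhds ht.1 ht.2
  have hIcc : Icc 0 b ∈ 𝓝 t :=
    mem_of_superset hnhds fun s hs => ⟨ha.trans hs.1.le, hs.2.le⟩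
  have hev := ((hw.continuousAt hIcc).eventually_const_lt hC').and hnhds
  obtain ⟨ε, hε, hball⟩ := Metric.eventually_nhds_iff_ball.1 hev
  let β : ContDiffBump t := ⟨ε / 2, ε, by positivity, by linarith⟩
  have hzero : ∀ s, s ∉ Metric.ball t ε → β s = 0 := by
    intro s hs
    exact Function.notMem_support.1 (by rwa [β.support_eq])
  have hβ : IsBump a b β := by
    refine ⟨β.contDiff, β.hasCompactSupport, fun t => β.nonneg, fun s hs => hzero s fun h => ?_,
      fun s hs => hzero s fun h => ?_⟩
    · exact absurd (hball s h).2.1 (not_lt.2 hs)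
    · exact absurd (hball s h).2.2 (not_lt.2 hs)
  have hint : ∫ s in Ici 0, C' * β s ≤ ∫ s in Ici 0, w s * β s := by
    refine integral_mono (hβ.integrable.const_mul C').integrableOn
      (integrableOn_Ici_mul hw β.continuous hβ.zero_of_ge) fun s => ?_
    by_cases hs : s ∈ Metric.ball t ε
    · exact mul_le_mul_of_nonneg_right (hball s hs).1.le β.nonneg
    · simp [hzero s hs]
  rw [integral_const_mul, setIntegral_eq_integral_of_forall_compl_eq_zero
    (s := Ici 0) (fun s hs => hβ.zero_of_le s ((le_of_not_ge hs).trans ha))] at hint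
  have := hint.trans (h β hβ)
  exact absurd (le_of_mul_le_mul_right this β.integral_pos) (not_le.2 hC)

/-! ### The weak comparison inequality and propagation of nonpositivity. -/

section Comparison

variable {α L b : ℝ} {r κ ψ : ℝ → ℝ}

theorem IsKernelPair.density_nonneg {K : ℝ → ℝ} (hk : IsKernelPair K L r κ) (hL : 0 < L)
    (x : ℝ) : 0 ≤ κ x :=
  (mul_nonneg hL.le (hk.nonneg x)).trans (hk.mul_le x)

/-- Testing the Caputo derivative with the forward average of a bump. -/
theorem IsKernelPair.exists_testFunction (hα₁ : α < 1)
    (hk : IsKernelPair (fun x => (Real.Gamma (1 + -α))⁻¹ * heavisidePow (-α) x) L r κ)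
    {a : ℝ} (hψ : IsBump a b ψ) {T : EReal} (hbT : (b : EReal) < T) :
    ∃ φ : 𝓓(past T, ℝ), (∀ t, φ t = forwardAverage r ψ t) ∧ ∀ u u₀,
      caputo α u₀ u φ = ∫ s in Ici 0, (u s - u₀) * (ψ s - forwardAverage κ ψ s) := by
  have hsupp : tsupport (forwardAverage r ψ) ⊆ past T := by
    have h1 : tsupport (forwardAverage r ψ) ⊆ Iic b := by
      refine closure_minimal (fun s hs => ?_) isClosed_Iic
      by_contra hsb
      exact hs (forwardAverage_eq_zero hk.zero_of_nonpos hψ.zero_of_ge (le_of_not_ge hsb))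
    intro s hs
    exact lt_of_le_of_lt (EReal.coe_le_coe_iff.2 (h1 hs)) hbT
  let φ : 𝓓(past T, ℝ) :=
    { toFun := forwardAverage r ψ
      contDiff' := contDiff_forwardAverage hk.integrable hψ.contDiff hψ.hasCompactSupport
      hasCompactSupport' :=
        hasCompactSupport_forwardAverage hk.hasCompactSupport hψ.hasCompactSupport
      tsupport_subset' := hsupp }
  refine ⟨φ, fun t => rfl, fun u u₀ => ?_⟩
  rw [caputo, convolve]
  refine setIntegral_congr_fun measurableSet_Ici fun s _ => ?_
  congr 1
  rw [abelDistribution_apply (by linarith), ← neg_integral_mul_forwardAverage_deriv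
    (fun R => (integrableOn_Iic_heavisidePow (by linarith) R).const_mul _)
    (fun x hx => by simp [heavisidePow, not_le.2 hx]) hk.integrable hk.zero_of_nonpos
    hk.density_integrable hk.density_zero_of_nonpos hk.density_integral hk.integral_mul_eq_tail
    hψ.contDiff hψ.hasCompactSupport hψ.zero_of_ge s]
  congr 2; ext x
  congr 1
  change deriv (fun x => forwardAverage r ψ (x + s)) x = _
  rw [deriv_comp_add_const, deriv_forwardAverage hk.integrable hψ.contDiff hψ.hasCompactSupport]

/-- Over `[0, ∞)` the average of `ψ` retains at most the fraction `∫_{(-∞, b]} κ` of the mass of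
`ψ`. The lost fraction, a tail of `κ`, is what transmits a strict gap in the initial values. -/
theorem IsKernelPair.mul_integral_le {K : ℝ → ℝ} (hk : IsKernelPair K L r κ) (hL : 0 < L)
    (hψ : IsBump 0 b ψ) :
    (∫ p in Ioi b, κ p) * ∫ t, ψ t ≤ ∫ s in Ici 0, (ψ s - forwardAverage κ ψ s) := by
  obtain ⟨h1, h2⟩ := setIntegral_forwardAverage_le hk.density_integrable (hk.density_nonneg hL)
    hψ.contDiff.continuous hψ.hasCompactSupport hψ.nonneg hψ.zero_of_ge 0
  rw [integral_sub hψ.integrable.integrableOn h1,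
    setIntegral_eq_integral_of_forall_compl_eq_zero (s := Ici 0)
      (fun s hs => hψ.zero_of_le s (le_of_not_ge hs))]
  have h3 : (∫ q in Iic b, κ q) + ∫ p in Ioi b, κ p = 1 := by
    rw [← hk.density_integral, ← compl_Iic]
    exact integral_add_compl measurableSet_Iic hk.density_integrable
  rw [sub_zero, eq_sub_of_add_eq h3] at h2
  linarith

/-- The difference of a subsolution and a supersolution, tested with a bump. -/
theorem IsKernelPair.integral_sub_mul_le (hα₁ : α < 1)
    (hk : IsKernelPair (fun x => (Real.Gamma (1 + -α))⁻¹ * heavisidePow (-α) x) L r κ)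
    (hL : 0 < L) {f : ℝ → ℝ → ℝ} {y z : ℝ → ℝ} {Ty Tz : EReal}
    (hf : ContinuousOn (fun p : ℝ × ℝ => f p.1 p.2) (Ici 0 ×ˢ univ))
    (hy : ContinuousOn y (Icc 0 b)) (hz : ContinuousOn z (Icc 0 b))
    (hyf : DistribLE (T := Ty) (ofFunction fun t => f t (y t)) (caputo α (y 0) y))
    (hzf : DistribLE (T := Tz) (caputo α (z 0) z) (ofFunction fun t => f t (z t)))
    (hbTy : (b : EReal) < Ty) (hbTz : (b : EReal) < Tz)
    (hlip : ∀ s ∈ Icc 0 b, |f s (z s) - f s (y s)| ≤ L * |z s - y s|)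
    (h₀ : z 0 ≤ y 0) (hψ : IsBump 0 b ψ) :
    ∫ s in Ici 0, (z s - y s) * ψ s ≤ (z 0 - y 0) * (∫ p in Ioi b, κ p) * (∫ t, ψ t)
      + ∫ s in Ici 0, max (z s - y s) 0 * forwardAverage (fun q => κ q + L * r q) ψ s := by
  have hψc := hψ.contDiff.continuous
  have hrψ := continuous_forwardAverage hk.integrable hψc hψ.hasCompactSupport
  have hκψ := continuous_forwardAverage hk.density_integrable hψc hψ.hasCompactSupport
  have hrb : ∀ t, b ≤ t → forwardAverage r ψ t = 0 := fun t =>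
    forwardAverage_eq_zero hk.zero_of_nonpos hψ.zero_of_ge
  have hκb : ∀ t, b ≤ t → forwardAverage κ ψ t = 0 := fun t =>
    forwardAverage_eq_zero hk.density_zero_of_nonpos hψ.zero_of_ge
  have hdb : ∀ t, b ≤ t → ψ t - forwardAverage κ ψ t = 0 := fun t ht => by
    rw [hψ.zero_of_ge t ht, hκb t ht, sub_zero]
  have hdc : Continuous fun t => ψ t - forwardAverage κ ψ t := hψc.sub hκψ
  have hr0 := forwardAverage_nonneg hk.nonneg hψ.nonneg
  have hcomp {u : ℝ → ℝ} (hu : ContinuousOn u (Icc 0 b)) :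
      ContinuousOn (fun s => f s (u s)) (Icc 0 b) :=
    hf.comp (f := fun s => (s, u s)) (continuousOn_id.prodMk hu) fun s hs => ⟨hs.1, mem_univ _⟩
  obtain ⟨φ, hφ, hφc⟩ := hk.exists_testFunction hα₁ hψ hbTy
  obtain ⟨χ, hχ, hχc⟩ := hk.exists_testFunction hα₁ hψ hbTz
  have hY := hyf φ fun t => by rw [hφ]; exact hr0 t
  have hZ := hzf χ fun t => by rw [hχ]; exact hr0 t
  rw [hφc, ofFunction] at hY
  rw [hχc, ofFunction] at hZ
  simp only [hφ] at hY
  simp only [hχ] at hZ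
  have iY := integrableOn_Ici_mul (hcomp hy) hrψ hrb
  have iZ := integrableOn_Ici_mul (hcomp hz) hrψ hrb
  have iY' := integrableOn_Ici_mul (v := fun s => y s - y 0)
    (hy.sub continuousOn_const) hdc hdb
  have iZ' := integrableOn_Ici_mul (v := fun s => z s - z 0)
    (hz.sub continuousOn_const) hdc hdb
  have hw : ContinuousOn (fun s => z s - y s) (Icc 0 b) := hz.sub hy
  have iψ := integrableOn_Ici_mul hw hψc hψ.zero_of_ge
  have id0 := integrableOn_Ici_mul (v := fun _ => z 0 - y 0) continuousOn_const hdc hdb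
  have iw := integrableOn_Ici_mul (v := fun s => max (z s - y s) 0) (b := b)
    (g := forwardAverage (fun q => κ q + L * r q) ψ) (hw.sup continuousOn_const)
    (continuous_forwardAverage (hk.density_integrable.add (hk.integrable.const_mul L)) hψc
      hψ.hasCompactSupport)
    (fun t => forwardAverage_eq_zero (fun q hq => by
      rw [hk.density_zero_of_nonpos q hq, hk.zero_of_nonpos q hq]; ring) hψ.zero_of_ge)
  -- With `w = z - y`, the initial values cancel on the right. If `w ≥ 0`, the Lipschitz bound is
  -- paid for by the `L r` part of the last term. If `w ≤ 0`, that term is zero and `L r ≤ κ` lets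
  -- `-w` times the `κ`-average pay instead.
  have hpt : ∀ s ∈ Ici (0 : ℝ), (z s - y s) * ψ s
      ≤ (((z s - z 0) * (ψ s - forwardAverage κ ψ s)
          - f s (z s) * forwardAverage r ψ s)
        - ((y s - y 0) * (ψ s - forwardAverage κ ψ s) - f s (y s) * forwardAverage r ψ s))
        + ((z 0 - y 0) * (ψ s - forwardAverage κ ψ s)
        + max (z s - y s) 0 * forwardAverage (fun q => κ q + L * r q) ψ s) := by
    intro s hs
    rw [forwardAverage_add_smul hk.density_integrable hk.integrable hψc hψ.hasCompactSupport]
    rcases le_or_gt b s with hsb | hsb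
    · rw [hψ.zero_of_ge s hsb, hκb s hsb, hrb s hsb]
      simp
    · have hA : L * forwardAverage r ψ s ≤ forwardAverage κ ψ s := by
        simp only [forwardAverage]
        rw [← integral_const_mul]
        refine integral_mono ((integrable_mul_comp_add hk.integrable hψc
          hψ.hasCompactSupport s).const_mul L)
          (integrable_mul_comp_add hk.density_integrable hψc hψ.hasCompactSupport s) fun q => ?_
        have := mul_le_mul_of_nonneg_right (hk.mul_le q) (hψ.nonneg (s + q))
        simpa [mul_assoc] using this
      have hB := hr0 s
      have hl := hlip s ⟨hs, hsb.le⟩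
      have hΔ := mul_le_mul_of_nonneg_right ((le_abs_self _).trans hl) hB
      rcases le_total 0 (z s - y s) with h | h
      · rw [max_eq_left h]
        rw [abs_of_nonneg h] at hΔ
        linarith
      · rw [max_eq_right h]
        rw [abs_of_nonpos h] at hΔ
        have := mul_le_mul_of_nonneg_left hA (neg_nonneg.2 h)
        linarith
  -- Once integrated, the `z` bracket is nonpositive by `hZ` and the `y` bracket nonnegative by
  -- `hY`.
  have hmain := setIntegral_mono_on iψ (((iZ'.sub iZ).sub (iY'.sub iY)).add (id0.add iw))
    measurableSet_Ici hpt
  rw [integral_add' ((iZ'.sub iZ).sub (iY'.sub iY)) (id0.add iw),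
    integral_sub' (iZ'.sub iZ) (iY'.sub iY), integral_sub' iZ' iZ, integral_sub' iY' iY,
    integral_add' id0 iw, integral_const_mul] at hmain
  have h0 := mul_le_mul_of_nonpos_left (hk.mul_integral_le hL hψ) (sub_nonpos.2 h₀)
  linarith

theorem exists_pos_setIntegral_Iic_lt_one {h : ℝ → ℝ} (hh : Integrable h)
    (h0 : ∀ x ≤ 0, h x = 0) : ∃ η > 0, ∫ q in Iic η, h q < 1 := by
  have hc : Continuous fun η => ∫ q in (0 : ℝ)..η, h q :=
    intervalIntegral.continuous_primitive (fun _ _ => hh.intervalIntegrable) 0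
  have hev : ∀ᶠ η in 𝓝[>] (0 : ℝ), ∫ q in (0 : ℝ)..η, h q < 1 :=
    ((hc.tendsto 0).eventually_lt_const (by simp)).filter_mono nhdsWithin_le_nhds
  obtain ⟨η, hη, hpos⟩ := (hev.and self_mem_nhdsWithin).exists
  refine ⟨η, hpos, lt_of_eq_of_lt ?_ hη⟩
  rw [intervalIntegral.integral_of_le (le_of_lt hpos)]
  refine setIntegral_eq_of_subset_of_forall_sdiff_eq_zero measurableSet_Iic Ioc_subset_Iic_self
    fun x hx => h0 x ?_
  by_contra! hx0
  exact hx.2 ⟨hx0, hx.1⟩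

/-- A continuous function that is dominated, in the weak sense, by the convolution of its positive
part with an integrable kernel is nonpositive. -/
theorem nonpos_of_integral_mul_bump_le {w h : ℝ → ℝ} (hw : ContinuousOn w (Icc 0 b))
    (hw0 : w 0 ≤ 0) (hh : Integrable h) (hnn : ∀ q, 0 ≤ h q) (hz : ∀ q ≤ 0, h q = 0)
    (H : ∀ e ≤ b, ∀ ψ, IsBump 0 e ψ →
      ∫ s in Ici 0, w s * ψ s ≤ ∫ s in Ici 0, max (w s) 0 * forwardAverage h ψ s) :
    ∀ t ∈ Icc 0 b, w t ≤ 0 := by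
  -- On a time step of length `η` the kernel is a strict contraction. The induction advances by such
  -- steps.
  obtain ⟨η, hη, hη1⟩ := exists_pos_setIntegral_Iic_lt_one hh hz
  have key : ∀ n : ℕ, ∀ t ∈ Icc 0 b, t ≤ n * η → w t ≤ 0 := by
    intro n
    induction n with
    | zero =>
      intro t ht htn
      obtain rfl : t = 0 := le_antisymm (by simpa using htn) ht.1
      exact hw0
    | succ n ih =>
      intro t ht htn
      set a : ℝ := n * η with ha_def
      have ha : 0 ≤ a := by positivity
      rcases le_or_gt t a with hta | hta
      · exact ih t ht hta
      set e := min (a + η) b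
      have heb : e ≤ b := min_le_right _ _
      have hte : t ≤ e := le_min (by push_cast at htn; linarith) ht.2
      have hae : a < e := hta.trans_le hte
      have hsub : Icc a e ⊆ Icc 0 b := Icc_subset_Icc ha heb
      obtain ⟨x, hx, hmax⟩ := isCompact_Icc.exists_isMaxOn ⟨t, hta.le, hte⟩ (hw.mono hsub)
      refine (hmax ⟨hta.le, hte⟩).trans ?_
      by_contra! hpos
      set ρ := ∫ q in Iic η, h q
      -- Before `a` the positive part is zero by induction, and on `[a, e]` it is at most the
      -- assumed positive maximum `w x`, so only kernel mass on `(-∞, η]` enters.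
      have hbound : ∀ s ∈ Ioo a e, w s ≤ ρ * w x := by
        refine le_of_integral_mul_bump_le ha (hw.mono (Icc_subset_Icc_right heb))
          fun ψ hψ => ?_
        have hψ' : IsBump 0 e ψ :=
          ⟨hψ.contDiff, hψ.hasCompactSupport, hψ.nonneg,
            fun s hs => hψ.zero_of_le s (hs.trans ha), hψ.zero_of_ge⟩
        have hψc := hψ.contDiff.continuous
        have hAnn := forwardAverage_nonneg hnn hψ.nonneg
        have hAb : ∀ s, e ≤ s → forwardAverage h ψ s = 0 := fun s =>
          forwardAverage_eq_zero hz hψ.zero_of_ge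
        obtain ⟨hi, hle⟩ := setIntegral_forwardAverage_le hh hnn hψc hψ.hasCompactSupport
          hψ.nonneg hψ.zero_of_ge a
        have hmono : ∫ q in Iic (e - a), h q ≤ ρ :=
          setIntegral_mono_set hh.integrableOn (Eventually.of_forall hnn)
            (Iic_subset_Iic.2 (by linarith [min_le_left (a + η) b])).eventuallyLE
        have hψI : 0 ≤ ∫ t, ψ t := integral_nonneg hψ.nonneg
        calc ∫ s in Ici 0, w s * ψ s
            ≤ ∫ s in Ici 0, max (w s) 0 * forwardAverage h ψ s := H e heb ψ hψ'
          _ ≤ ∫ s in Ici 0, (Ici a).indicator (fun s => w x * forwardAverage h ψ s) s := by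
              refine setIntegral_mono_on (integrableOn_Ici_mul
                ((hw.mono (Icc_subset_Icc_right heb)).sup continuousOn_const)
                (continuous_forwardAverage hh hψc hψ.hasCompactSupport) hAb)
                (IntegrableOn.integrable_indicator (hi.const_mul (w x)) measurableSet_Ici).integrableOn
                measurableSet_Ici fun s hs => ?_
              rcases lt_or_ge s a with hsa | hsa
              · rw [indicator_of_notMem (by simpa using hsa)]
                rcases le_or_gt s b with hsb | hsb
                · rw [max_eq_right (ih s ⟨hs, hsb⟩ hsa.le), zero_mul]
                · linarith
              · rw [indicator_of_mem (by simpa using hsa)]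
                rcases le_or_gt e s with hes | hes
                · rw [hAb s hes]; simp
                · exact mul_le_mul_of_nonneg_right (max_le (hmax ⟨hsa, hes.le⟩) hpos.le)
                    (hAnn s)
          _ = w x * ∫ s in Ici a, forwardAverage h ψ s := by
              rw [setIntegral_indicator measurableSet_Ici,
                inter_eq_right.2 (Ici_subset_Ici.2 ha), integral_const_mul]
          _ ≤ w x * (ρ * ∫ t, ψ t) := by
              refine mul_le_mul_of_nonneg_left (hle.trans ?_) hpos.le
              exact mul_le_mul_of_nonneg_right hmono hψI
          _ = _ := by ring
      have hcl : closure (Ioo a e) = Icc a e := closure_Ioo hae.ne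
      -- The maximizer `x` may be an endpoint. Passing to the closure gives `w x ≤ ρ * w x` with `ρ
      -- < 1`, a contradiction.
      have := le_on_closure hbound (by rw [hcl]; exact hw.mono hsub) continuousOn_const
        (by rwa [hcl])
      nlinarith
  intro t ht
  obtain ⟨n, hn⟩ := exists_nat_ge (t / η)
  exact key n t ht ((div_le_iff₀ hη).1 hn)

end Comparison

end FracComparison

end

/-! ### The comparison theorem. -/

theorem theorem3p1 (α : ℝ) (hα₀ : 0 < α) (hα₁ : α < 1)
    (f : ℝ → ℝ → ℝ)
    (hf : ContinuousOn (fun p : ℝ × ℝ => f p.1 p.2) (Ici 0 ×ˢ univ))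
    (hfLip : FracComparison.LocallyLipschitzInState f)
    (Ty Tz : EReal) (hTy : 0 < Ty) (hTz : 0 < Tz)
    (y z : ℝ → ℝ)
    (hy : ContinuousOn y (FracComparison.existInterval Ty))
    (hz : ContinuousOn z (FracComparison.existInterval Tz))
    (hyf : FracComparison.DistribLE (T := Ty)
      (FracComparison.ofFunction (fun t => f t (y t))) (FracComparison.caputo α (y 0) y))
    (hzf : FracComparison.DistribLE (T := Tz)
      (FracComparison.caputo α (z 0) z) (FracComparison.ofFunction (fun t => f t (z t))))
    (h₀ : z 0 ≤ y 0) :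
    (∀ t ∈ FracComparison.existInterval Ty ∩ FracComparison.existInterval Tz, z t ≤ y t) ∧
      (z 0 < y 0 →
        ∀ t ∈ FracComparison.existInterval Ty ∩ FracComparison.existInterval Tz, z t < y t) := by
  suffices h : ∀ t ∈ FracComparison.existInterval Ty ∩ FracComparison.existInterval Tz,
      z t ≤ y t ∧ (z 0 < y 0 → z t < y t) from
    ⟨fun t ht => (h t ht).1, fun h0 t ht => (h t ht).2 h0⟩
  rintro t ⟨⟨ht0, htTy⟩, -, htTz⟩
  -- A `b` strictly beyond `t` leaves room for bumps around `t` and keeps `[0, b]` compact inside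
  -- both intervals.
  obtain ⟨b, htb, hb⟩ := EReal.lt_iff_exists_real_btwn.1 (lt_min htTy htTz)
  rw [EReal.coe_lt_coe_iff] at htb
  obtain ⟨hbTy, hbTz⟩ := lt_min_iff.1 hb
  have hy' : ContinuousOn y (Icc 0 b) := hy.mono fun s hs =>
    ⟨hs.1, (EReal.coe_le_coe_iff.2 hs.2).trans_lt hbTy⟩
  have hz' : ContinuousOn z (Icc 0 b) := hz.mono fun s hs =>
    ⟨hs.1, (EReal.coe_le_coe_iff.2 hs.2).trans_lt hbTz⟩
  have hw : ContinuousOn (fun s => z s - y s) (Icc 0 b) := hz'.sub hy'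
  obtain ⟨L, hL, hlip⟩ := FracComparison.exists_pos_lipschitz_along hf hfLip hy' hz'
  obtain ⟨r, κ, hk⟩ := FracComparison.exists_isKernelPair (c := (Real.Gamma (1 + -α))⁻¹) hα₀ hα₁
    (inv_pos.2 (Real.Gamma_pos_of_pos (by linarith))) hL
  have hmain (e : ℝ) (heb : e ≤ b) (ψ : ℝ → ℝ) (hψ : FracComparison.IsBump 0 e ψ) :=
    hk.integral_sub_mul_le hα₁ hL hf (hy'.mono (Icc_subset_Icc_right heb))
      (hz'.mono (Icc_subset_Icc_right heb)) hyf hzf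
      ((EReal.coe_le_coe_iff.2 heb).trans_lt hbTy) ((EReal.coe_le_coe_iff.2 heb).trans_lt hbTz)
      (fun s hs => hlip s ⟨hs.1, hs.2.trans heb⟩) h₀ hψ
  have hle : ∀ s ∈ Icc 0 b, z s - y s ≤ 0 := by
    refine FracComparison.nonpos_of_integral_mul_bump_le (h := fun q => κ q + L * r q) hw
      (sub_nonpos.2 h₀) (hk.density_integrable.add (hk.integrable.const_mul L))
      (fun q => add_nonneg (hk.density_nonneg hL q) (mul_nonneg hL.le (hk.nonneg q)))
      (fun q hq => by
        rw [hk.density_zero_of_nonpos q hq, hk.zero_of_nonpos q hq, mul_zero, add_zero])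
      fun e heb ψ hψ => (hmain e heb ψ hψ).trans ?_
    have h1 : 0 ≤ ∫ p in Ioi e, κ p := integral_nonneg fun p => hk.density_nonneg hL p
    have h2 : 0 ≤ ∫ t, ψ t := integral_nonneg hψ.nonneg
    have h3 := mul_nonpos_of_nonpos_of_nonneg (mul_nonpos_of_nonpos_of_nonneg
      (sub_nonpos.2 h₀) h1) h2
    linarith
  refine ⟨sub_nonpos.1 (hle t ⟨ht0, htb.le⟩), fun hlt => ?_⟩
  rcases ht0.eq_or_lt with rfl | ht0
  · exact hlt
  have hγ := hk.tail_pos b (ht0.trans htb)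
  -- Since `w⁺ = 0` is now known, the convolution term drops out and only the strictly negative
  -- initial contribution remains.
  have hst := FracComparison.le_of_integral_mul_bump_le le_rfl hw
    (C := (z 0 - y 0) * ∫ p in Ioi b, κ p) (fun ψ hψ => (hmain b le_rfl ψ hψ).trans (by
      refine (add_eq_left.2 (setIntegral_eq_zero_of_forall_eq_zero fun s hs => ?_)).le
      rcases le_or_gt b s with hbs | hbs
      · rw [FracComparison.forwardAverage_eq_zero (fun q hq => by
          rw [hk.density_zero_of_nonpos q hq, hk.zero_of_nonpos q hq, mul_zero, add_zero])
          hψ.zero_of_ge hbs, mul_zero]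
      · rw [max_eq_right (hle s ⟨hs, hbs.le⟩), zero_mul])) t ⟨ht0, htb⟩
  have := mul_neg_of_neg_of_pos (sub_neg.2 hlt) hγ
  linarith
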